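/- A tournament $T$ on a finite vertex set is an orientation of the complete graph. For a vertex $i$, let $N^{+}(i)$ and $N^{-}(i)$ be the subtournaments induced by the set of vertices dominated by $i$ and by the set of vertices dominating $i$, respectively. A tournament of order $n$ is regular if every vertex has out-degree $\frac{n-1}{2}$; a regular tournament is doubly-regular if, for every vertex $i$, both $N^{+}(i)$ and $N^{-}(i)$ are regular tournaments (of order $\frac{n-1}{2}$). Let $c_8(T)$ be the number of (directed) cycles of length $8$ in $T$, where a cycle has pairwise distinct vertices and cycles that differ only by the choice of the starting vertex are identified. Then for every doubly-regular tournament $DR_n$ of order $n$, $$c_8(DR_n)=\frac{(n+1)\,n\,(n-1)(n-3)^{2}(n-7)(n^{2}-7n+1)}{2048}.$$ -/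

import Mathlib

/-- A tournament: an orientation of the complete graph on the vertex set `V`. There are no loops,
and of any two distinct vertices exactly one dominates the other. -/
def IsTournament {V : Type*} (T : Digraph V) : Prop :=
  (∀ i, ¬ T.Adj i i) ∧ ∀ i j, i ≠ j → Xor (T.Adj i j) (T.Adj j i)

/-- The set of vertices dominated by `i`. -/
def outSet {V : Type*} (T : Digraph V) (i : V) : Set V := {j | T.Adj i j}

/-- The set of vertices dominating `i`. -/
def inSet {V : Type*} (T : Digraph V) (i : V) : Set V := {j | T.Adj j i}

/-- The subdigraph of `T` induced by a set `S` of vertices. -/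
def inducedDigraph {V : Type*} (T : Digraph V) (S : Set V) : Digraph S where
  Adj i j := T.Adj i.1 j.1

/-- A regular tournament on a finite vertex set of cardinality `n`: a tournament all of whose
out-degrees are equal to `(n - 1) / 2`, written without subtraction and division. -/
def IsRegularTournament {V : Type*} (T : Digraph V) : Prop :=
  IsTournament T ∧ ∀ i, 2 * (outSet T i).ncard + 1 = Nat.card V

/-- A doubly-regular tournament: a regular tournament in which the out-set and the in-set of every
vertex induce regular tournaments. -/
def IsDoublyRegularTournament {V : Type*} (T : Digraph V) : Prop :=
  IsRegularTournament T ∧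
    ∀ i, IsRegularTournament (inducedDigraph T (outSet T i)) ∧
      IsRegularTournament (inducedDigraph T (inSet T i))

/-- The set of directed cycles of length `m` in `T`: cyclic sequences (lists up to rotation) of `m`
pairwise distinct vertices, each of which dominates the next one, cyclically. -/
def mCycles {V : Type*} (T : Digraph V) (m : ℕ) : Set (Cycle V) :=
  {c | c.length = m ∧ c.Nodup ∧ c.Chain T.Adj}

/-- The number `c_m(T)` of cycles of length `m` in `T`. -/
noncomputable def numCycles {V : Type*} (T : Digraph V) (m : ℕ) : ℕ := (mCycles T m).ncard

/-! Let A be the adjacency matrix and n = 4k + 3. Double regularity gives A Aᵀ = Aᵀ A = (2k+1) I + k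
(A + Aᵀ). Together with A + Aᵀ = J − I, this makes the span of I, A, Aᵀ closed under the matrix
product. These are 0-1 matrices with disjoint supports, so the span is closed under the entrywise
product too (`sum_comb_mul_comb`, `comb_mul_comb`). The structure constants involve only k, so every
count built from the two products is a polynomial in k.

An 8-cycle is the same as eight closed walks of length 8 with distinct vertices. In a closed walk,
positions at cyclic distance 1 or 2 never coincide (no loops, no 2-cycles). Only the 8 pairs at
distance 3 and the 4 pairs at distance 4 can. In the inclusion-exclusion over these 12 pairs most
products vanish, since they would force a loop or a 2-cycle; up to rotation 13 survive
(`prod_one_sub_chords`, `coincidenceTerm`).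

Each surviving pattern folds the walk into paths between at most three marked vertices, or into a
4-cycle traversed twice. Paths are counted by powers of A, parallel paths by entrywise products, so
each term can be evaluated in the span. -/

open Finset

/-! ### The algebra spanned by I, A and Aᵀ -/

/-- The 0-1 adjacency matrix of a digraph. -/
noncomputable def adjEntry {V : Type*} (T : Digraph V) (x y : V) : ℚ :=
  open Classical in if T.Adj x y then 1 else 0

/-- The combination of the identity matrix, a matrix and its transpose with given coefficients. -/
def matrixComb {V : Type*} [DecidableEq V] (A : V → V → ℚ) (s : ℚ × ℚ × ℚ) (x y : V) : ℚ :=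
  s.1 * (if x = y then 1 else 0) + s.2.1 * A x y + s.2.2 * A y x

/-- A 0-1 matrix with the properties of the adjacency matrix of a doubly-regular tournament
of order `4 * k + 3`. -/
structure IsDoublyRegularMatrix {V : Type*} [Fintype V] [DecidableEq V] (A : V → V → ℚ) (k : ℚ) :
    Prop where
  zero_or_one : ∀ x y, A x y = 0 ∨ A x y = 1
  diag : ∀ x, A x x = 0
  asymm : ∀ x y, A x y * A y x = 0
  total : ∀ x y, A x y + A y x = 1 - if x = y then 1 else 0
  card : (Fintype.card V : ℚ) = 4 * k + 3
  row : ∀ x, ∑ y, A x y = 2 * k + 1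
  mul_transpose : ∀ x y, ∑ z, A x z * A y z =
    (2 * k + 1) * (if x = y then 1 else 0) + k * A x y + k * A y x
  transpose_mul : ∀ x y, ∑ z, A z x * A z y =
    (2 * k + 1) * (if x = y then 1 else 0) + k * A x y + k * A y x

/-- The coefficients of a matrix product. -/
def combMul (k : ℚ) (s t : ℚ × ℚ × ℚ) : ℚ × ℚ × ℚ :=
  (s.1 * t.1 + (2 * k + 1) * (s.2.1 * t.2.2 + s.2.2 * t.2.1),
   s.1 * t.2.1 + s.2.1 * t.1 + k * (s.2.1 * t.2.1) + (k + 1) * (s.2.2 * t.2.2)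
    + k * (s.2.1 * t.2.2 + s.2.2 * t.2.1),
   s.1 * t.2.2 + s.2.2 * t.1 + (k + 1) * (s.2.1 * t.2.1) + k * (s.2.2 * t.2.2)
    + k * (s.2.1 * t.2.2 + s.2.2 * t.2.1))

/-- The coefficients of a power of the matrix, with exponent shifted by one. -/
def combPow (k : ℚ) : ℕ → ℚ × ℚ × ℚ
  | 0 => (0, 1, 0)
  | m + 1 => combMul k (0, 1, 0) (combPow k m)

namespace IsDoublyRegularMatrix

variable {V : Type*} [Fintype V] [DecidableEq V] {A : V → V → ℚ} {k : ℚ}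

/-- Substituting A = J − I − Aᵀ in the second factor gives A² = (2k+1) J − A − A Aᵀ, and J = I + A +
Aᵀ. -/
theorem sq (h : IsDoublyRegularMatrix A k) (x y : V) :
    ∑ z, A x z * A z y = k * A x y + (k + 1) * A y x := by
  have e : ∀ z, A x z * A z y = A x z - (if z = y then A x z else 0) - A x z * A y z := by
    intro z
    have h1 := h.total z y
    split_ifs at h1 ⊢ <;> linear_combination A x z * h1
  simp only [e, sum_sub_distrib, h.row, h.mul_transpose, sum_ite_eq', mem_univ, if_true]
  linear_combination (-2 * k - 1) * h.total x y

theorem col (h : IsDoublyRegularMatrix A k) (y : V) : ∑ x, A x y = 2 * k + 1 := by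
  have e : ∀ x, A x y = 1 - (if x = y then 1 else 0) - A y x := fun x => by
    linear_combination h.total x y
  rw [sum_congr rfl fun x _ => e x]
  simp only [sum_sub_distrib, h.row, sum_ite_eq', mem_univ, if_true, sum_const, card_univ,
    nsmul_eq_mul, mul_one, h.card]
  ring

theorem sum_comb_mul_comb (h : IsDoublyRegularMatrix A k) (s t : ℚ × ℚ × ℚ) (x y : V) :
    ∑ z, matrixComb A s x z * matrixComb A t z y = matrixComb A (combMul k s t) x y := by
  have e : ∀ z, matrixComb A s x z * matrixComb A t z y =
      (if x = z then s.1 * matrixComb A t z y else 0) +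
      (if z = y then t.1 * (s.2.1 * A x z + s.2.2 * A z x) else 0) +
      s.2.1 * t.2.1 * (A x z * A z y) + s.2.2 * t.2.2 * (A y z * A z x) +
      s.2.1 * t.2.2 * (A x z * A y z) + s.2.2 * t.2.1 * (A z x * A z y) := by
    intro z
    simp only [matrixComb]
    split_ifs <;> ring
  simp only [e, sum_add_distrib, ← mul_sum, h.sq, h.mul_transpose, h.transpose_mul, sum_ite_eq,
    sum_ite_eq', mem_univ, if_true]
  simp only [matrixComb, combMul]
  ring

/-- I, A and Aᵀ have disjoint supports and entries 0 or 1, so they are orthogonal idempotents for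
the entrywise product. -/
theorem comb_mul_comb (h : IsDoublyRegularMatrix A k) (s t : ℚ × ℚ × ℚ) (x y : V) :
    matrixComb A s x y * matrixComb A t x y = matrixComb A (s * t) x y := by
  simp only [matrixComb, Prod.fst_mul, Prod.snd_mul]
  by_cases hxy : x = y
  · subst hxy
    simp [h.diag]
  · have h1 := h.asymm x y
    have h2 : A x y + A y x = 1 := by simpa [hxy] using h.total x y
    rcases h.zero_or_one x y with h3 | h3
    · have h4 : A y x = 1 := by linarith
      simp [h3, h4, hxy]
    · have h4 : A y x = 0 := by linarith
      simp [h3, h4, hxy]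

theorem comb_self (h : IsDoublyRegularMatrix A k) (s : ℚ × ℚ × ℚ) (x : V) :
    matrixComb A s x x = s.1 := by
  simp [matrixComb, h.diag]

theorem sum_comb (h : IsDoublyRegularMatrix A k) (s : ℚ × ℚ × ℚ) (x : V) :
    ∑ y, matrixComb A s x y = s.1 + (2 * k + 1) * (s.2.1 + s.2.2) := by
  simp only [matrixComb, sum_add_distrib, ← mul_sum, h.row, h.col, sum_ite_eq, mem_univ, if_true]
  ring

theorem sum_mul_pow (h : IsDoublyRegularMatrix A k) (m : ℕ) (x y : V) :
    ∑ z, A x z * matrixComb A (combPow k m) z y = matrixComb A (combPow k (m + 1)) x y := by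
  rw [combPow, ← h.sum_comb_mul_comb]
  simp [matrixComb]

theorem sum_triangle (h : IsDoublyRegularMatrix A k) (s t u : ℚ × ℚ × ℚ) (x : V) :
    ∑ y, ∑ z, matrixComb A s x y * (matrixComb A t y z * matrixComb A u z x) =
      (combMul k s (combMul k t u)).1 := by
  simp only [← mul_sum, h.sum_comb_mul_comb, h.comb_self]

end IsDoublyRegularMatrix

theorem matrixComb_swap {V : Type*} [DecidableEq V] (A : V → V → ℚ) (s : ℚ × ℚ × ℚ) (x y : V) :
    matrixComb A s y x = matrixComb A (s.1, s.2.2, s.2.1) x y := by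
  simp only [matrixComb, eq_comm (a := y)]
  ring

theorem matrixComb_pow_zero {V : Type*} [DecidableEq V] (A : V → V → ℚ) (k : ℚ) (x y : V) :
    matrixComb A (combPow k 0) x y = A x y := by
  simp [matrixComb, combPow]

/-! ### From doubly-regular tournaments to matrix identities -/

theorem IsTournament.adjEntry_total {V : Type*} [DecidableEq V] {T : Digraph V}
    (hT : IsTournament T) (x y : V) :
    adjEntry T x y + adjEntry T y x = 1 - if x = y then 1 else 0 := by
  by_cases hxy : x = y
  · subst hxy
    simp [adjEntry, hT.1]
  · rcases hT.2 x y hxy with ⟨h1, h2⟩ | ⟨h1, h2⟩ <;> simp [adjEntry, h1, h2, hxy]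

theorem sum_adjEntry_eq_ncard {V : Type*} [Fintype V] (T : Digraph V) (x : V) :
    ∑ y, adjEntry T x y = ((outSet T x).ncard : ℚ) := by
  classical
  simp only [adjEntry, sum_boole]
  rw [← Set.ncard_coe_finset]
  simp [outSet]

theorem sum_adjEntry_mul_eq_ncard {V : Type*} [Fintype V] (T : Digraph V) (S : Set V)
    (x : S) (f : V → ℚ) (hf : ∀ z, f z = open Classical in if z ∈ S then 1 else 0) :
    ∑ z, f z * adjEntry T x z = ((outSet (inducedDigraph T S) x).ncard : ℚ) := by
  classical
  have e : (outSet (inducedDigraph T S) x).ncard = (S ∩ outSet T x).ncard := by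
    rw [← Set.ncard_image_of_injective _ Subtype.val_injective]
    congr 1
    ext z
    simp [outSet, inducedDigraph, and_comm]
  rw [e]
  simp only [hf, adjEntry, ite_mul, one_mul, zero_mul, ← ite_and, sum_boole]
  rw [← Set.ncard_coe_finset]
  simp [outSet, Set.inter_def]

theorem IsDoublyRegularTournament.isDoublyRegularMatrix {V : Type*} [Fintype V] [DecidableEq V]
    {T : Digraph V} (hT : IsDoublyRegularTournament T) :
    IsDoublyRegularMatrix (adjEntry T) (((Fintype.card V : ℚ) - 3) / 4) := by
  classical
  -- Rational k suffices: integrality of (n − 3)/4 is never needed.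
  set k : ℚ := ((Fintype.card V : ℚ) - 3) / 4 with hk
  obtain ⟨⟨ht, hr⟩, hd⟩ := hT
  have total := ht.adjEntry_total
  have card : (Fintype.card V : ℚ) = 4 * k + 3 := by rw [hk]; ring
  have row : ∀ x, ∑ y, adjEntry T x y = 2 * k + 1 := by
    intro x
    have h1 := hr x
    rw [Nat.card_eq_fintype_card] at h1
    have h2 : (2 * (outSet T x).ncard + 1 : ℚ) = Fintype.card V := by exact_mod_cast h1
    rw [sum_adjEntry_eq_ncard]
    linarith
  have col : ∀ y, ∑ x, adjEntry T x y = 2 * k + 1 := by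
    intro y
    have e : ∀ x, adjEntry T x y = 1 - (if x = y then 1 else 0) - adjEntry T y x := fun x => by
      linear_combination total x y
    rw [sum_congr rfl fun x _ => e x]
    simp only [sum_sub_distrib, row, sum_ite_eq', mem_univ, if_true, sum_const, card_univ,
      nsmul_eq_mul, mul_one, card]
    ring
  have idem : ∀ x y, adjEntry T x y * adjEntry T x y = adjEntry T x y := by
    intro x y; simp [adjEntry]
  have entry : ∀ {x y}, T.Adj x y → adjEntry T x y = 1 ∧ adjEntry T y x = 0 := by
    intro x y hxy
    have hne : x ≠ y := by rintro rfl; exact ht.1 _ hxy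
    have h1 := total x y
    have h2 : adjEntry T x y = 1 := by simp [adjEntry, hxy]
    simp only [hne, if_false] at h1
    exact ⟨h2, by linarith⟩
  -- The common out-neighbours of x and y are the out-neighbours of y inside N⁺(x), a regular
  -- tournament of order 2k + 1.
  have outCount : ∀ {x y}, T.Adj x y → ∑ z, adjEntry T x z * adjEntry T y z = k := by
    intro x y hxy
    have h1 := (hd x).1.2 ⟨y, hxy⟩
    have h2 := sum_adjEntry_mul_eq_ncard T (outSet T x) ⟨y, hxy⟩ (adjEntry T x) fun z => rfl
    have h3 := sum_adjEntry_eq_ncard T x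
    rw [row] at h3
    rw [Nat.card_coe_set_eq] at h1
    have h4 : (2 * (outSet (inducedDigraph T (outSet T x)) ⟨y, hxy⟩).ncard + 1 : ℚ)
      = (outSet T x).ncard := by exact_mod_cast h1
    rw [h2]
    linarith
  -- Here z runs over the in-neighbours of x inside N⁻(y). Out of 2k + 1 vertices, remove x and its
  -- k out-neighbours there.
  have inCount : ∀ {x y}, T.Adj x y → ∑ z, adjEntry T z x * adjEntry T z y = k := by
    intro x y hxy
    have h1 := (hd y).2.2 ⟨x, hxy⟩
    have h2 := sum_adjEntry_mul_eq_ncard T (inSet T y) ⟨x, hxy⟩ (fun z => adjEntry T z y)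
      fun z => rfl
    have h3 : ((inSet T y).ncard : ℚ) = 2 * k + 1 := by
      rw [← col y]
      simp only [adjEntry, sum_boole]
      rw [← Set.ncard_coe_finset]
      simp [inSet]
    rw [Nat.card_coe_set_eq] at h1
    have h4 : (2 * (outSet (inducedDigraph T (inSet T y)) ⟨x, hxy⟩).ncard + 1 : ℚ)
      = (inSet T y).ncard := by exact_mod_cast h1
    have e : ∀ z, adjEntry T z x * adjEntry T z y = adjEntry T z y
        - (if z = x then adjEntry T z y else 0) - adjEntry T z y * adjEntry T x z := by
      intro z
      have h5 := total z x
      split_ifs at h5 ⊢ <;> linear_combination adjEntry T z y * h5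
    simp only [e, sum_sub_distrib, col, h2, sum_ite_eq', mem_univ, if_true, (entry hxy).1]
    linarith
  have diag : ∀ x, adjEntry T x x = 0 := fun x => by simp [adjEntry, ht.1]
  refine ⟨?_, diag, ?_, total, card, row, ?_, ?_⟩
  · intro x y
    by_cases h : T.Adj x y <;> simp [adjEntry, h]
  · intro x y
    by_cases h : T.Adj x y
    · simp [(entry h).2]
    · simp [adjEntry, h]
  · intro x y
    by_cases hxy : x = y
    · subst hxy
      simp [idem, row, diag]
    · rcases ht.2 x y hxy with ⟨h, -⟩ | ⟨h, -⟩
      · simp [outCount h, entry h, hxy]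
      · simp only [mul_comm (adjEntry T x _), outCount h, entry h, hxy]
        simp
  · intro x y
    by_cases hxy : x = y
    · subst hxy
      simp [idem, col, diag]
    · rcases ht.2 x y hxy with ⟨h, -⟩ | ⟨h, -⟩
      · simp [inCount h, entry h, hxy]
      · simp only [mul_comm (adjEntry T _ x), inCount h, entry h, hxy]
        simp

/-! ### Cycles as closed sequences of eight distinct vertices -/

theorem exists_ofFn_eq {V : Type*} {l : List V} : ∀ {m : ℕ}, l.length = m →
    ∃ x : Fin m → V, List.ofFn x = l := by
  rintro _ rfl
  exact ⟨l.get, List.ofFn_get l⟩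

/-- The weight of a closed sequence of eight vertices. -/
def walkWeight {V : Type*} (A : V → V → ℚ) (x : Fin 8 → V) : ℚ := ∏ i, A (x i) (x (i + 1))

theorem mem_mCycles_ofFn_iff {V : Type*} (T : Digraph V) (x : Fin 8 → V) :
    (List.ofFn x : Cycle V) ∈ mCycles T 8 ↔
      Function.Injective x ∧ ∀ i, T.Adj (x i) (x (i + 1)) := by
  have h : Cycle.Chain T.Adj (List.ofFn x : Cycle V) ↔ ∀ i, T.Adj (x i) (x (i + 1)) := by
    simp only [List.ofFn_succ, List.ofFn_zero, Cycle.chain_coe_cons, Fin.forall_fin_succ]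
    simp
  simp only [mCycles, Set.mem_ofPred_eq, Cycle.length_coe, List.length_ofFn, true_and,
    Cycle.nodup_coe_iff, List.nodup_ofFn, h]

theorem eight_mul_numCycles {V : Type*} [Fintype V] [DecidableEq V] (T : Digraph V) :
    (8 * numCycles T 8 : ℚ) = ∑ x : Fin 8 → V, walkWeight (adjEntry T) x *
      open Classical in if Function.Injective x then 1 else 0 := by
  classical
  have hw : ∀ x : Fin 8 → V, (walkWeight (adjEntry T) x * if Function.Injective x then 1 else 0) =
      if (List.ofFn x : Cycle V) ∈ mCycles T 8 then 1 else 0 := by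
    intro x
    simp only [mem_mCycles_ofFn_iff, walkWeight, adjEntry, prod_boole, mem_univ, true_implies]
    by_cases h1 : Function.Injective x <;> simp [h1]
  simp only [hw, sum_boole]
  set X : Finset (Fin 8 → V) := {x | (List.ofFn x : Cycle V) ∈ mCycles T 8} with hX
  have hmem : ∀ x, x ∈ X ↔ (List.ofFn x : Cycle V) ∈ mCycles T 8 := fun x => by simp [hX]
  let f : (Fin 8 → V) → Cycle V := fun x => (List.ofFn x : Cycle V)
  have himage : (X.image f : Set (Cycle V)) = mCycles T 8 := by
    ext c
    simp only [coe_image, Set.mem_image, mem_coe, hmem]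
    constructor
    · rintro ⟨x, hx, rfl⟩
      exact hx
    · intro hc
      induction c using Quotient.inductionOn' with | h l => ?_
      obtain ⟨x, rfl⟩ := exists_ofFn_eq (show l.length = 8 from hc.1)
      exact ⟨x, hc, rfl⟩
  -- The fibre over a cycle consists of its rotations, and these are 8 different sequences because
  -- the vertices are distinct.
  have hfiber : ∀ c ∈ X.image f, #{x ∈ X | f x = c} = 8 := by
    intro c hc
    obtain ⟨y, hy, rfl⟩ := mem_image.1 hc
    have hnd : (List.ofFn y).Nodup := ((hmem y).1 hy).2.1
    have e : ({x ∈ X | f x = f y} : Finset _).image List.ofFn =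
        (List.ofFn y).cyclicPermutations.toFinset := by
      ext l
      simp only [mem_image, mem_filter, hmem, List.mem_toFinset, List.mem_cyclicPermutations_iff]
      constructor
      · rintro ⟨x, ⟨-, hx⟩, rfl⟩
        exact Cycle.coe_eq_coe.1 hx
      · intro hl
        have hlen : l.length = 8 := by rw [hl.perm.length_eq]; simp
        obtain ⟨x, rfl⟩ := exists_ofFn_eq hlen
        have hx : f x = f y := Cycle.coe_eq_coe.2 hl
        refine ⟨x, ⟨?_, hx⟩, rfl⟩
        change f x ∈ _
        rw [hx]
        exact (hmem y).1 hy
    rw [← card_image_of_injective _ List.ofFn_injective, e,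
      List.toFinset_card_of_nodup hnd.cyclicPermutations,
      List.length_cyclicPermutations_of_ne_nil _ (by simp)]
    simp
  have hcard := card_eq_sum_card_image f X
  rw [sum_congr rfl hfiber, sum_const, smul_eq_mul] at hcard
  rw [numCycles, ← himage, Set.ncard_coe_finset, hcard]
  push_cast
  ring

/-! ### Inclusion-exclusion over coincidences in a closed walk -/

/-- Indices of a nonzero product of the s i differ pairwise by ±1 or ±2 modulo 8, so they lie among
three consecutive indices. -/
theorem prod_one_sub_of_short {R : Type*} [CommRing R] (s : Fin 8 → R)
    (h3 : ∀ i, s i * s (i + 3) = 0) (h4 : ∀ i, s i * s (i + 4) = 0) :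
    ∏ i, (1 - s i) = 1 + ∑ i, (- s i + s i * s (i + 1) + s i * s (i + 2)
      - s i * s (i + 1) * s (i + 2)) := by
  have a := h3 0
  have b := h3 1
  have c := h3 2
  have d := h3 3
  have e := h3 4
  have f := h3 5
  have g := h3 6
  have h := h3 7
  have i := h4 0
  have j := h4 1
  have k := h4 2
  have l := h4 3
  simp only [Fin.prod_univ_eight, Fin.sum_univ_eight]
  clear h3 h4
  simp [Fin.isValue, Fin.reduceAdd] at *
  generalize s 0 = s0, s 1 = s1, s 2 = s2, s 3 = s3, s 4 = s4, s 5 = s5, s 6 = s6, s 7 = s7 at *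
  grind

/-- The l i have period 4, so a sum over eight rotations repeats each product of them. The factors
1/2, 1/4 and 1/8 undo this: l i * l (i + 2) occurs four times, the full product eight times, the
others twice. A factor s i kills l i and l (i + 3), which leaves few mixed terms. -/
theorem prod_one_sub_chords (s l : Fin 8 → ℚ)
    (h3 : ∀ i, s i * s (i + 3) = 0) (h4 : ∀ i, s i * s (i + 4) = 0) (hl : ∀ i, l (i + 4) = l i)
    (hsl : ∀ i, s i * l i = 0) (hsl3 : ∀ i, s i * l (i + 3) = 0) :
    (∏ i, (1 - s i)) * ((1 - l 0) * (1 - l 1) * (1 - l 2) * (1 - l 3)) = 1 + ∑ i,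
      (- l i / 2 + l i * l (i + 1) / 2 + l i * l (i + 2) / 4 - l i * l (i + 1) * l (i + 2) / 2
      + l i * l (i + 1) * l (i + 2) * l (i + 3) / 8 - s i + s i * l (i + 1) + s i * l (i + 2)
      - s i * l (i + 1) * l (i + 2) + s i * s (i + 1) - s i * s (i + 1) * l (i + 2)
      + s i * s (i + 2) - s i * s (i + 1) * s (i + 2)) := by
  have e4 : l 4 = l 0 := hl 0
  have e5 : l 5 = l 1 := hl 1
  have e6 : l 6 = l 2 := hl 2
  have e7 : l 7 = l 3 := hl 3
  set L := (1 - l 0) * (1 - l 1) * (1 - l 2) * (1 - l 3) with hL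
  have rot : ∀ i, L = (1 - l i) * (1 - l (i + 1)) * (1 - l (i + 2)) * (1 - l (i + 3)) := by
    intro i
    fin_cases i <;> simp [e4, e5, e6, e7, hL] <;> ring
  have long : L = 1 + ∑ i, (- l i / 2 + l i * l (i + 1) / 2 + l i * l (i + 2) / 4
      - l i * l (i + 1) * l (i + 2) / 2 + l i * l (i + 1) * l (i + 2) * l (i + 3) / 8) := by
    rw [hL]
    simp [Fin.sum_univ_eight, e4, e5, e6, e7]
    ring
  have one : ∀ i, s i * L = s i * ((1 - l (i + 1)) * (1 - l (i + 2))) := by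
    intro i
    rw [rot i]
    linear_combination (-(1 - l (i + 1)) * (1 - l (i + 2)) * (1 - l (i + 3))) * hsl i
      - (1 - l (i + 1)) * (1 - l (i + 2)) * hsl3 i
  have two : ∀ i, s i * s (i + 1) * L = s i * s (i + 1) * (1 - l (i + 2)) := by
    intro i
    linear_combination s (i + 1) * one i - s i * (1 - l (i + 2)) * hsl (i + 1)
  have two' : ∀ i, s i * s (i + 2) * L = s i * s (i + 2) := by
    intro i
    have h5 := hsl3 (i + 2)
    have e : i + 2 + 3 = i + 1 + 4 := by rw [add_assoc, add_assoc]; rfl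
    rw [e, hl] at h5
    linear_combination s (i + 2) * one i - s i * (1 - l (i + 1)) * hsl (i + 2) - s i * h5
  have three : ∀ i, s i * s (i + 1) * s (i + 2) * L = s i * s (i + 1) * s (i + 2) := by
    intro i
    linear_combination s (i + 1) * two' i
  rw [prod_one_sub_of_short s h3 h4, add_mul, one_mul, sum_mul]
  nth_rewrite 1 [long]
  rw [add_assoc, ← sum_add_distrib]
  congr 1
  refine sum_congr rfl fun i _ => ?_
  linear_combination -one i + two i + two' i - three i

/-- Equality of two vertices, as a number. -/
def eqEntry {V : Type*} [DecidableEq V] (a b : V) : ℚ := if a = b then 1 else 0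

/-- Equality of two entries of a sequence, as a number. -/
def coincidence {V : Type*} [DecidableEq V] (x : Fin 8 → V) (i j : Fin 8) : ℚ :=
  eqEntry (x i) (x j)

/-- The inclusion-exclusion terms for the coincidences in a closed walk of length eight, one for
each rotation class. -/
def coincidenceTerm {V : Type*} [DecidableEq V] (x : Fin 8 → V) : ℚ :=
  let s := fun i => coincidence x i (i + 3)
  let l := fun i => coincidence x i (i + 4)
  l 0 * l 1 / 2 - l 0 / 2 + l 0 * l 2 / 4 - l 0 * l 1 * l 2 / 2
    + l 0 * l 1 * l 2 * l 3 / 8 - s 0 + s 0 * l 1 + s 0 * l 2 - s 0 * l 1 * l 2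
    + s 0 * s 1 - s 0 * s 1 * l 2 + s 0 * s 2 - s 0 * s 1 * s 2

/-- The weight is invariant under rotation, so the eight rotations of an inclusion-exclusion term
contribute equally. -/
theorem sum_walkWeight_mul_shift {V : Type*} [Fintype V] [DecidableEq V] (A : V → V → ℚ)
    (f : (Fin 8 → V) → ℚ) (i : Fin 8) :
    ∑ x, walkWeight A x * f (fun j => x (i + j)) = ∑ x, walkWeight A x * f x := by
  refine Fintype.sum_equiv ((Equiv.addLeft i).symm.arrowCongr (Equiv.refl V)) _ _ fun x => ?_
  have hx : ((Equiv.addLeft i).symm.arrowCongr (Equiv.refl V)) x = fun j => x (i + j) := by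
    ext j
    simp [Equiv.arrowCongr]
  rw [hx]
  congr 1
  exact (Fintype.prod_equiv (Equiv.addLeft i) _ _ fun j => by simp [add_assoc]).symm

theorem IsDoublyRegularMatrix.walkWeight_mul_injective {V : Type*} [Fintype V] [DecidableEq V]
    {A : V → V → ℚ} {k : ℚ} (h : IsDoublyRegularMatrix A k) (x : Fin 8 → V) :
    (walkWeight A x * open Classical in if Function.Injective x then 1 else 0) =
      walkWeight A x * (1 + ∑ i, coincidenceTerm fun j => x (i + j)) := by
  classical
  by_cases hw : walkWeight A x = 0
  · simp [hw]
  congr 1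
  have adj : ∀ i, A (x i) (x (i + 1)) ≠ 0 := fun i h0 => hw (prod_eq_zero (mem_univ i) h0)
  have ne1 : ∀ i, x i ≠ x (i + 1) := fun i e => adj i (by rw [← e, h.diag])
  -- Otherwise two steps of the walk would traverse the same pair of vertices in opposite
  -- directions.
  have no2 : ∀ i j, x i = x (j + 1) → x (i + 1) ≠ x j := by
    intro i j e e'
    have h1 := h.asymm (x i) (x (i + 1))
    rcases mul_eq_zero.1 h1 with h1 | h1
    · exact adj i h1
    · rw [e, e'] at h1
      exact adj j h1
  have ne2 : ∀ i, x i ≠ x (i + 2) := by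
    intro i e
    refine no2 i (i + 1) ?_ rfl
    rw [e, add_assoc]
    rfl
  -- With distances 1 and 2 excluded, injectivity only has to be tested on the chords of length 3
  -- and 4.
  have hinj : (if Function.Injective x then 1 else 0 : ℚ) =
      (∏ i, (1 - coincidence x i (i + 3))) * ((1 - coincidence x 0 4) * (1 - coincidence x 1 5) *
        (1 - coincidence x 2 6) * (1 - coincidence x 3 7)) := by
    by_cases hi : Function.Injective x
    · have e : ∀ i j, i ≠ j → coincidence x i j = 0 := by
        intro i j hij
        simp [coincidence, eqEntry, hi.ne hij]
      rw [if_pos hi, e 0 4 (by decide), e 1 5 (by decide), e 2 6 (by decide), e 3 7 (by decide)]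
      simp [e]
    · rw [if_neg hi, eq_comm]
      by_contra hne
      simp only [mul_ne_zero_iff, prod_ne_zero_iff, mem_univ, true_implies] at hne
      obtain ⟨hs, ⟨⟨h0, h1⟩, h2⟩, h3⟩ := hne
      have e : ∀ {i j}, 1 - coincidence x i j ≠ 0 → x i ≠ x j := by
        intro i j h0 h1
        simp [coincidence, eqEntry, h1] at h0
      refine hi fun i j hij => ?_
      have ne3 := fun i => e (hs i)
      have ne40 := e h0
      have ne41 := e h1
      have ne42 := e h2
      have ne43 := e h3
      by_contra hne
      have a0 := ne1 i
      have a1 := ne1 j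
      have a2 := ne2 i
      have a3 := ne2 j
      have a4 := ne3 i
      have a5 := ne3 j
      clear ne1 ne2 ne3 hs h0 h1 h2 h3 no2 adj e h hi hw
      fin_cases i <;> fin_cases j <;> simp_all
  have mul_zero' : ∀ {i j a b}, (x i = x j → x a ≠ x b) →
      coincidence x i j * coincidence x a b = 0 := by
    intro i j a b e
    by_cases h1 : x i = x j
    · simp [coincidence, eqEntry, e h1]
    · simp [coincidence, eqEntry, h1]
  have key := prod_one_sub_chords (fun i => coincidence x i (i + 3))
    (fun i => coincidence x i (i + 4)) ?_ ?_ ?_ ?_ ?_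
  · rw [hinj]
    refine Eq.trans ?_ (key.trans ?_)
    · rfl
    · simp only [coincidenceTerm]
      congr 1
      refine sum_congr rfl fun i _ => ?_
      have e : ∀ a b, i + a + b = i + (a + b) := fun a b => add_assoc i a b
      simp only [coincidence, eqEntry, e, zero_add, add_zero]
      ring
  -- Two such chords in a row identify positions i and i + 6, which are at cyclic distance 2.
  · refine fun i => mul_zero' fun e e' => ne2 (i + 6) ?_
    rw [show i + 6 = i + 3 + 3 by rw [add_assoc]; rfl, ← e', ← e]
    congr 1
    simp only [add_assoc]
    exact (add_zero i).symm
  -- The steps from i + 3 to i + 4 and from i + 7 to i would be opposite.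
  · refine fun i => mul_zero' fun e e' => no2 (i + 3) (i + 7) ?_ ?_
    · rw [← e, add_assoc]
      congr 1
      exact (add_zero i).symm
    · rw [show i + 3 + 1 = i + 4 by rw [add_assoc]; rfl, e', add_assoc]
      rfl
  · intro i
    have e : i + 4 + 4 = i := by rw [add_assoc]; exact add_zero i
    simp only [coincidence, eqEntry, e, eq_comm]
  · refine fun i => mul_zero' fun e e' => ne1 (i + 3) ?_
    rw [← e, e', add_assoc]
    rfl
  · refine fun i => mul_zero' fun e e' => ne1 (i + 3 + 4) ?_
    rw [← e', ← e]
    simp only [add_assoc]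
    congr 1
    exact (add_zero i).symm

theorem eight_mul_numCycles_eq {V : Type*} [Fintype V] [DecidableEq V] {T : Digraph V} {k : ℚ}
    (h : IsDoublyRegularMatrix (adjEntry T) k) :
    (8 * numCycles T 8 : ℚ) = ∑ x, walkWeight (adjEntry T) x +
      8 * ∑ x, walkWeight (adjEntry T) x * coincidenceTerm x := by
  rw [eight_mul_numCycles, sum_congr rfl fun x _ => h.walkWeight_mul_injective x]
  simp only [mul_add, mul_one, sum_add_distrib, mul_sum]
  rw [sum_comm]
  simp only [← mul_sum, sum_walkWeight_mul_shift, sum_const, card_univ, Fintype.card_fin,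
    nsmul_eq_mul]
  push_cast
  rw [mul_sum]

/-! ### Evaluation of the coincidence sums -/

theorem sum_fin_succ_fun {V R : Type*} [Fintype V] [AddCommMonoid R] {m : ℕ}
    (f : (Fin (m + 1) → V) → R) : ∑ x, f x = ∑ a, ∑ x : Fin m → V, f (Matrix.vecCons a x) := by
  rw [← Fintype.sum_prod_type']
  exact (Fintype.sum_equiv (Fin.consEquiv fun _ => V) _ _ fun _ => rfl).symm

theorem sum_fin_eight_fun {V R : Type*} [Fintype V] [AddCommMonoid R]
    (f : (Fin 8 → V) → R) : ∑ x, f x =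
      ∑ a, ∑ b, ∑ c, ∑ d, ∑ e, ∑ p, ∑ q, ∑ r, f ![a, b, c, d, e, p, q, r] := by
  simp only [sum_fin_succ_fun, Fintype.sum_unique,
    show (default : Fin 0 → V) = ![] from Subsingleton.elim _ _]

theorem walkWeight_vec {V : Type*} (A : V → V → ℚ) (a b c d e p q r : V) :
    walkWeight A ![a, b, c, d, e, p, q, r] =
      A a b * (A b c * (A c d * (A d e * (A e p * (A p q * (A q r * A r a)))))) := by
  simp only [walkWeight, Fin.prod_univ_eight, mul_assoc]
  rfl

/-- Eliminates an identified vertex. The sums below are rearranged so that each equality factor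
stands directly after the arc entering the vertex it eliminates. -/
theorem sum_mul_eqEntry_mul {V : Type*} [Fintype V] [DecidableEq V] (f g : V → ℚ) (y : V) :
    ∑ x, f x * (eqEntry y x * g x) = f y * g y := by
  simp [eqEntry]

/-- The coefficients of the transpose. -/
def combSwap (s : ℚ × ℚ × ℚ) : ℚ × ℚ × ℚ := (s.1, s.2.2, s.2.1)

/-- The sum of all entries of a combination. -/
def combSum (k : ℚ) (s : ℚ × ℚ × ℚ) : ℚ := (4 * k + 3) * (s.1 + (2 * k + 1) * (s.2.1 + s.2.2))

namespace IsDoublyRegularMatrix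

variable {V : Type*} [Fintype V] [DecidableEq V] {A : V → V → ℚ} {k : ℚ}

theorem sum_mul (h : IsDoublyRegularMatrix A k) (x y : V) :
    ∑ z, A x z * A z y = matrixComb A (combPow k 1) x y := by
  simp only [← h.sum_mul_pow, matrixComb_pow_zero]

theorem sum_mul_mul (h : IsDoublyRegularMatrix A k) (x y : V) (c : ℚ) :
    ∑ z, A x z * (A z y * c) = matrixComb A (combPow k 1) x y * c := by
  simp only [← h.sum_mul, Finset.sum_mul, mul_assoc]

theorem sum_mul_pow_mul (h : IsDoublyRegularMatrix A k) (m : ℕ) (x y : V) (c : ℚ) :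
    ∑ z, A x z * (matrixComb A (combPow k m) z y * c) =
     matrixComb A (combPow k (m + 1)) x y * c := by
  simp only [← h.sum_mul_pow, Finset.sum_mul, mul_assoc]

/-- Contracts an intermediate vertex y when the next vertex z is marked and must stay as a summation
variable. -/
theorem sum_mul_sum (h : IsDoublyRegularMatrix A k) (x : V) (f : V → ℚ) :
    ∑ y, A x y * ∑ z, A y z * f z = ∑ z, matrixComb A (combPow k 1) x z * f z := by
  simp only [mul_sum, ← h.sum_mul, Finset.sum_mul]
  rw [sum_comm]
  simp only [mul_assoc]

/-- For walks folded onto two marked vertices: four paths alternate between x and y. Transposing the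
returning ones makes all four parallel. -/
theorem sum_hadamard_four (h : IsDoublyRegularMatrix A k) (s t u v : ℚ × ℚ × ℚ) :
    ∑ x, ∑ y, matrixComb A s x y * (matrixComb A t y x *
      (matrixComb A u x y * matrixComb A v y x)) =
    combSum k (s * (combSwap t * (u * combSwap v))) := by
  have e : ∀ x y, matrixComb A s x y * (matrixComb A t y x *
      (matrixComb A u x y * matrixComb A v y x)) =
      matrixComb A (s * (combSwap t * (u * combSwap v))) x y := by
    intro x y
    rw [matrixComb_swap A t, matrixComb_swap A v]
    simp only [h.comb_mul_comb, combSwap]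
  simp only [e, h.sum_comb, sum_const, card_univ, nsmul_eq_mul, h.card, combSum]

/-- For walks folded onto three marked vertices: the walk runs twice around x, y, z, so each side
carries two parallel paths, and the merged sides form a trace. -/
theorem sum_hadamard_triangle (h : IsDoublyRegularMatrix A k) (s t u s' t' u' : ℚ × ℚ × ℚ) :
    ∑ x, ∑ y, matrixComb A s x y * ∑ z, matrixComb A t y z * (matrixComb A u z x *
      (matrixComb A s' x y * (matrixComb A t' y z * matrixComb A u' z x))) =
    (4 * k + 3) * (combMul k (s * s') (combMul k (t * t') (u * u'))).1 := by
  have e : ∀ x y z, matrixComb A s x y * (matrixComb A t y z * (matrixComb A u z x *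
      (matrixComb A s' x y * (matrixComb A t' y z * matrixComb A u' z x)))) =
      matrixComb A (s * s') x y * (matrixComb A (t * t') y z * matrixComb A (u * u') z x) := by
    intro x y z
    simp only [← h.comb_mul_comb]
    ring
  simp only [mul_sum, e]
  simp only [h.sum_triangle, sum_const, card_univ, nsmul_eq_mul, h.card]

theorem sum_walkWeight (h : IsDoublyRegularMatrix A k) :
    ∑ x, walkWeight A x =
      (4 * k + 3) * (combPow k 7).1 := by
  simp only [sum_fin_eight_fun, walkWeight_vec]
  simp only [← mul_sum, h.sum_mul_pow, h.sum_mul, h.comb_self,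
    sum_const, card_univ, nsmul_eq_mul, h.card]

/-- One coincidence splits the walk into two closed walks at a common vertex. Since `combPow k m`
encodes the power m + 1 of A, the index 3 stands for length 4. -/
theorem sum_walkWeight_04 (h : IsDoublyRegularMatrix A k) :
    ∑ x, walkWeight A x * (coincidence x 0 4) =
      (4 * k + 3) * ((combPow k 3).1 * (combPow k 3).1) := by
  have e : ∀ a b c d e p q r : V, walkWeight A ![a, b, c, d, e, p, q, r] *
        (coincidence ![a, b, c, d, e, p, q, r] 0 4) =
      A a b * (A b c * (A c d * (A d e * (eqEntry a e * (A e p * (A p q * (A q r * A r a))))))) := by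
    intro a b c d e p q r
    simp only [walkWeight_vec, coincidence, Fin.isValue, Matrix.cons_val]
    ring
  simp only [sum_fin_eight_fun, e]
  simp only [← mul_sum, h.sum_mul_pow, h.sum_mul, sum_mul_eqEntry_mul, h.sum_mul_mul, h.sum_mul_pow_mul, h.comb_self,
    sum_const, card_univ, nsmul_eq_mul, h.card]
  ring

theorem sum_walkWeight_04_15 (h : IsDoublyRegularMatrix A k) :
    ∑ x, walkWeight A x * (coincidence x 0 4 * coincidence x 1 5) =
      combSum k (combPow k 0 * (combSwap (combPow k 2) *
      (combPow k 0 * combSwap (combPow k 2)))) := by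
  have e : ∀ a b c d e p q r : V, walkWeight A ![a, b, c, d, e, p, q, r] *
        (coincidence ![a, b, c, d, e, p, q, r] 0 4 * coincidence ![a, b, c, d, e, p, q, r] 1 5) =
      A a b * (A b c * (A c d * (A d e * (eqEntry a e * (
        A e p * (eqEntry b p * (A p q * (A q r * A r a)))))))) := by
    intro a b c d e p q r
    simp only [walkWeight_vec, coincidence, Fin.isValue, Matrix.cons_val]
    ring
  simp only [sum_fin_eight_fun, e]
  simp only [← mul_sum, h.sum_mul_pow, h.sum_mul, sum_mul_eqEntry_mul,
    h.sum_mul_mul, h.sum_mul_pow_mul, Nat.reduceAdd]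
  simpa only [matrixComb_pow_zero] using
    h.sum_hadamard_four (combPow k 0) (combPow k 2) (combPow k 0) (combPow k 2)

theorem sum_walkWeight_04_26 (h : IsDoublyRegularMatrix A k) :
    ∑ x, walkWeight A x * (coincidence x 0 4 * coincidence x 2 6) =
      combSum k (combPow k 1 * (combSwap (combPow k 1) *
      (combPow k 1 * combSwap (combPow k 1)))) := by
  have e : ∀ a b c d e p q r : V, walkWeight A ![a, b, c, d, e, p, q, r] *
        (coincidence ![a, b, c, d, e, p, q, r] 0 4 * coincidence ![a, b, c, d, e, p, q, r] 2 6) =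
      A a b * (A b c * (A c d * (A d e * (eqEntry a e * (
        A e p * (A p q * (eqEntry c q * (A q r * A r a)))))))) := by
    intro a b c d e p q r
    simp only [walkWeight_vec, coincidence, Fin.isValue, Matrix.cons_val]
    ring
  simp only [sum_fin_eight_fun, e]
  simp only [← mul_sum, h.sum_mul, sum_mul_eqEntry_mul,
    h.sum_mul_mul, h.sum_mul_sum]
  simpa only [matrixComb_pow_zero] using
    h.sum_hadamard_four (combPow k 1) (combPow k 1) (combPow k 1) (combPow k 1)

theorem sum_walkWeight_04_15_26 (h : IsDoublyRegularMatrix A k) :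
    ∑ x, walkWeight A x * (coincidence x 0 4 * coincidence x 1 5 * coincidence x 2 6) =
      (4 * k + 3) * (combMul k (combPow k 0 * combPow k 0)
      (combMul k (combPow k 0 * combPow k 0) (combPow k 1 * combPow k 1))).1 := by
  have e : ∀ a b c d e p q r : V, walkWeight A ![a, b, c, d, e, p, q, r] *
        (coincidence ![a, b, c, d, e, p, q, r] 0 4 * coincidence ![a, b, c, d, e, p, q, r] 1 5 * coincidence ![a, b, c, d, e, p, q, r] 2 6) =
      A a b * (A b c * (A c d * (A d e * (eqEntry a e * (
        A e p * (eqEntry b p * (A p q * (eqEntry c q * (A q r * A r a))))))))) := by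
    intro a b c d e p q r
    simp only [walkWeight_vec, coincidence, Fin.isValue, Matrix.cons_val]
    ring
  simp only [sum_fin_eight_fun, e]
  simp only [← mul_sum, h.sum_mul, sum_mul_eqEntry_mul,
    h.sum_mul_mul]
  simpa only [matrixComb_pow_zero] using
    h.sum_hadamard_triangle (combPow k 0) (combPow k 0) (combPow k 1) (combPow k 0) (combPow k 0) (combPow k 1)

theorem sum_walkWeight_04_15_26_37 (h : IsDoublyRegularMatrix A k) :
    ∑ x, walkWeight A x * (coincidence x 0 4 * coincidence x 1 5 * coincidence x 2 6 * coincidence x 3 7) =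
      (4 * k + 3) * (combPow k 3).1 := by
  have e : ∀ a b c d e p q r : V, walkWeight A ![a, b, c, d, e, p, q, r] *
        (coincidence ![a, b, c, d, e, p, q, r] 0 4 * coincidence ![a, b, c, d, e, p, q, r] 1 5 * coincidence ![a, b, c, d, e, p, q, r] 2 6 *
          coincidence ![a, b, c, d, e, p, q, r] 3 7) =
      A a b * (A b c * (A c d * (A d e * (eqEntry a e * (
        A e p * (eqEntry b p * (A p q * (eqEntry c q * (A q r * (eqEntry d r * A r a)))))))))) := by
    intro a b c d e p q r
    simp only [walkWeight_vec, coincidence, Fin.isValue, Matrix.cons_val]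
    ring
  simp only [sum_fin_eight_fun, e]
  simp only [← mul_sum, sum_mul_eqEntry_mul]
  -- All four chords of length 4 make the walk run twice around a closed 4-walk; entries are 0 or 1,
  -- so the second round changes nothing.
  have e' : ∀ a b c d, A a b * (A b c * (A c d * (A d a * (A a b * (A b c * (A c d * A d a)))))) =
      A a b * (A b c * (A c d * A d a)) := by
    intro a b c d
    rcases h.zero_or_one a b with h1 | h1 <;> rcases h.zero_or_one b c with h2 | h2 <;>
      rcases h.zero_or_one c d with h3 | h3 <;> simp [h1, h2, h3]
    rcases h.zero_or_one d a with h4 | h4 <;> simp [h4]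
  simp only [mul_sum, e']
  simp only [← mul_sum, h.sum_mul, h.sum_mul_pow, h.comb_self, sum_const, card_univ,
    nsmul_eq_mul, h.card]

theorem sum_walkWeight_03 (h : IsDoublyRegularMatrix A k) :
    ∑ x, walkWeight A x * (coincidence x 0 3) =
      (4 * k + 3) * ((combPow k 2).1 * (combPow k 4).1) := by
  have e : ∀ a b c d e p q r : V, walkWeight A ![a, b, c, d, e, p, q, r] *
        (coincidence ![a, b, c, d, e, p, q, r] 0 3) =
      A a b * (A b c * (A c d * (eqEntry a d * (A d e * (A e p * (A p q * (A q r * A r a))))))) := by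
    intro a b c d e p q r
    simp only [walkWeight_vec, coincidence, Fin.isValue, Matrix.cons_val]
    ring
  simp only [sum_fin_eight_fun, e]
  simp only [← mul_sum, h.sum_mul_pow, h.sum_mul, sum_mul_eqEntry_mul, h.sum_mul_mul, h.sum_mul_pow_mul, h.comb_self,
    sum_const, card_univ, nsmul_eq_mul, h.card]
  ring

theorem sum_walkWeight_03_15 (h : IsDoublyRegularMatrix A k) :
    ∑ x, walkWeight A x * (coincidence x 0 3 * coincidence x 1 5) =
      combSum k (combPow k 0 * (combSwap (combPow k 1) *
      (combPow k 1 * combSwap (combPow k 2)))) := by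
  have e : ∀ a b c d e p q r : V, walkWeight A ![a, b, c, d, e, p, q, r] *
        (coincidence ![a, b, c, d, e, p, q, r] 0 3 * coincidence ![a, b, c, d, e, p, q, r] 1 5) =
      A a b * (A b c * (A c d * (eqEntry a d * (A d e * (
        A e p * (eqEntry b p * (A p q * (A q r * A r a)))))))) := by
    intro a b c d e p q r
    simp only [walkWeight_vec, coincidence, Fin.isValue, Matrix.cons_val]
    ring
  simp only [sum_fin_eight_fun, e]
  simp only [← mul_sum, h.sum_mul_pow, h.sum_mul, sum_mul_eqEntry_mul,
    h.sum_mul_mul, Nat.reduceAdd]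
  simpa only [matrixComb_pow_zero] using
    h.sum_hadamard_four (combPow k 0) (combPow k 1) (combPow k 1) (combPow k 2)

theorem sum_walkWeight_03_26 (h : IsDoublyRegularMatrix A k) :
    ∑ x, walkWeight A x * (coincidence x 0 3 * coincidence x 2 6) =
      combSum k (combPow k 1 * (combSwap (combPow k 0) *
      (combPow k 2 * combSwap (combPow k 1)))) := by
  have e : ∀ a b c d e p q r : V, walkWeight A ![a, b, c, d, e, p, q, r] *
        (coincidence ![a, b, c, d, e, p, q, r] 0 3 * coincidence ![a, b, c, d, e, p, q, r] 2 6) =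
      A a b * (A b c * (A c d * (eqEntry a d * (A d e * (
        A e p * (A p q * (eqEntry c q * (A q r * A r a)))))))) := by
    intro a b c d e p q r
    simp only [walkWeight_vec, coincidence, Fin.isValue, Matrix.cons_val]
    ring
  simp only [sum_fin_eight_fun, e]
  simp only [← mul_sum, h.sum_mul, sum_mul_eqEntry_mul,
    h.sum_mul_mul, h.sum_mul_pow_mul, h.sum_mul_sum, Nat.reduceAdd]
  simpa only [matrixComb_pow_zero] using
    h.sum_hadamard_four (combPow k 1) (combPow k 0) (combPow k 2) (combPow k 1)

/-- The folded walk is a → b → c → a → e → b → c → r → a; the sides ab, bc, ca carry paths of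
lengths 1 and 2, 1 and 1, 1 and 2. -/
theorem sum_walkWeight_03_15_26 (h : IsDoublyRegularMatrix A k) :
    ∑ x, walkWeight A x * (coincidence x 0 3 * coincidence x 1 5 * coincidence x 2 6) =
      (4 * k + 3) * (combMul k (combPow k 0 * combPow k 1)
      (combMul k (combPow k 0 * combPow k 0) (combPow k 0 * combPow k 1))).1 := by
  have e : ∀ a b c d e p q r : V, walkWeight A ![a, b, c, d, e, p, q, r] *
        (coincidence ![a, b, c, d, e, p, q, r] 0 3 * coincidence ![a, b, c, d, e, p, q, r] 1 5 * coincidence ![a, b, c, d, e, p, q, r] 2 6) =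
      A a b * (A b c * (A c d * (eqEntry a d * (A d e * (
        A e p * (eqEntry b p * (A p q * (eqEntry c q * (A q r * A r a))))))))) := by
    intro a b c d e p q r
    simp only [walkWeight_vec, coincidence, Fin.isValue, Matrix.cons_val]
    ring
  simp only [sum_fin_eight_fun, e]
  simp only [← mul_sum, h.sum_mul, sum_mul_eqEntry_mul,
    h.sum_mul_mul]
  simpa only [matrixComb_pow_zero] using
    h.sum_hadamard_triangle (combPow k 0) (combPow k 0) (combPow k 0) (combPow k 1) (combPow k 0) (combPow k 1)

theorem sum_walkWeight_03_14 (h : IsDoublyRegularMatrix A k) :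
    ∑ x, walkWeight A x * (coincidence x 0 3 * coincidence x 1 4) =
      combSum k (combPow k 0 * (combSwap (combPow k 1) *
      (combPow k 0 * combSwap (combPow k 3)))) := by
  have e : ∀ a b c d e p q r : V, walkWeight A ![a, b, c, d, e, p, q, r] *
        (coincidence ![a, b, c, d, e, p, q, r] 0 3 * coincidence ![a, b, c, d, e, p, q, r] 1 4) =
      A a b * (A b c * (A c d * (eqEntry a d * (A d e * (eqEntry b e * (
        A e p * (A p q * (A q r * A r a)))))))) := by
    intro a b c d e p q r
    simp only [walkWeight_vec, coincidence, Fin.isValue, Matrix.cons_val]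
    ring
  simp only [sum_fin_eight_fun, e]
  simp only [← mul_sum, h.sum_mul_pow, h.sum_mul, sum_mul_eqEntry_mul,
    h.sum_mul_mul, Nat.reduceAdd]
  simpa only [matrixComb_pow_zero] using
    h.sum_hadamard_four (combPow k 0) (combPow k 1) (combPow k 0) (combPow k 3)

theorem sum_walkWeight_03_14_26 (h : IsDoublyRegularMatrix A k) :
    ∑ x, walkWeight A x * (coincidence x 0 3 * coincidence x 1 4 * coincidence x 2 6) =
      (4 * k + 3) * (combMul k (combPow k 0 * combPow k 0)
      (combMul k (combPow k 0 * combPow k 1) (combPow k 0 * combPow k 1))).1 := by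
  have e : ∀ a b c d e p q r : V, walkWeight A ![a, b, c, d, e, p, q, r] *
        (coincidence ![a, b, c, d, e, p, q, r] 0 3 * coincidence ![a, b, c, d, e, p, q, r] 1 4 * coincidence ![a, b, c, d, e, p, q, r] 2 6) =
      A a b * (A b c * (A c d * (eqEntry a d * (A d e * (eqEntry b e * (
        A e p * (A p q * (eqEntry c q * (A q r * A r a))))))))) := by
    intro a b c d e p q r
    simp only [walkWeight_vec, coincidence, Fin.isValue, Matrix.cons_val]
    ring
  simp only [sum_fin_eight_fun, e]
  simp only [← mul_sum, h.sum_mul, sum_mul_eqEntry_mul,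
    h.sum_mul_mul]
  simpa only [matrixComb_pow_zero] using
    h.sum_hadamard_triangle (combPow k 0) (combPow k 0) (combPow k 0) (combPow k 0) (combPow k 1) (combPow k 1)

theorem sum_walkWeight_03_25 (h : IsDoublyRegularMatrix A k) :
    ∑ x, walkWeight A x * (coincidence x 0 3 * coincidence x 2 5) =
      combSum k (combPow k 1 * (combSwap (combPow k 0) *
      (combPow k 1 * combSwap (combPow k 2)))) := by
  have e : ∀ a b c d e p q r : V, walkWeight A ![a, b, c, d, e, p, q, r] *
        (coincidence ![a, b, c, d, e, p, q, r] 0 3 * coincidence ![a, b, c, d, e, p, q, r] 2 5) =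
      A a b * (A b c * (A c d * (eqEntry a d * (A d e * (
        A e p * (eqEntry c p * (A p q * (A q r * A r a)))))))) := by
    intro a b c d e p q r
    simp only [walkWeight_vec, coincidence, Fin.isValue, Matrix.cons_val]
    ring
  simp only [sum_fin_eight_fun, e]
  simp only [← mul_sum, h.sum_mul_pow, h.sum_mul, sum_mul_eqEntry_mul,
    h.sum_mul_mul, h.sum_mul_sum, Nat.reduceAdd]
  simpa only [matrixComb_pow_zero] using
    h.sum_hadamard_four (combPow k 1) (combPow k 0) (combPow k 1) (combPow k 2)

theorem sum_walkWeight_03_14_25 (h : IsDoublyRegularMatrix A k) :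
    ∑ x, walkWeight A x * (coincidence x 0 3 * coincidence x 1 4 * coincidence x 2 5) =
      (4 * k + 3) * (combMul k (combPow k 0 * combPow k 0)
      (combMul k (combPow k 0 * combPow k 0) (combPow k 0 * combPow k 2))).1 := by
  have e : ∀ a b c d e p q r : V, walkWeight A ![a, b, c, d, e, p, q, r] *
        (coincidence ![a, b, c, d, e, p, q, r] 0 3 * coincidence ![a, b, c, d, e, p, q, r] 1 4 * coincidence ![a, b, c, d, e, p, q, r] 2 5) =
      A a b * (A b c * (A c d * (eqEntry a d * (A d e * (eqEntry b e * (
        A e p * (eqEntry c p * (A p q * (A q r * A r a))))))))) := by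
    intro a b c d e p q r
    simp only [walkWeight_vec, coincidence, Fin.isValue, Matrix.cons_val]
    ring
  simp only [sum_fin_eight_fun, e]
  simp only [← mul_sum, h.sum_mul_pow, h.sum_mul, sum_mul_eqEntry_mul, Nat.reduceAdd]
  simpa only [matrixComb_pow_zero] using
    h.sum_hadamard_triangle (combPow k 0) (combPow k 0) (combPow k 0) (combPow k 0) (combPow k 0) (combPow k 2)

end IsDoublyRegularMatrix

/-! ### Explicit polynomials in k and the final count -/

theorem combPow_1 (k : ℚ) : combPow k 1 = (0, k, k + 1) := by
  rw [combPow, combPow, combMul]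
  ext <;> ring

theorem combPow_2 (k : ℚ) : combPow k 2 = (2 * k ^ 2 + 3 * k + 1, 2 * k ^ 2 + k, 2 * k ^ 2 + 2 * k) := by
  rw [combPow, combPow_1, combMul]
  ext <;> ring

theorem combPow_3 (k : ℚ) : combPow k 3 = (4 * k ^ 3 + 6 * k ^ 2 + 2 * k,
    4 * k ^ 3 + 5 * k ^ 2 + 3 * k + 1,
    4 * k ^ 3 + 5 * k ^ 2 + k) := by
  rw [combPow, combPow_2, combMul]
  ext <;> ring

theorem combPow_4 (k : ℚ) : combPow k 4 = (8 * k ^ 4 + 14 * k ^ 3 + 7 * k ^ 2 + k,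
    8 * k ^ 4 + 14 * k ^ 3 + 10 * k ^ 2 + 3 * k,
    8 * k ^ 4 + 14 * k ^ 3 + 9 * k ^ 2 + 4 * k + 1) := by
  rw [combPow, combPow_3, combMul]
  ext <;> ring

theorem combPow_5 (k : ℚ) : combPow k 5 = (16 * k ^ 5 + 36 * k ^ 4 + 32 * k ^ 3 + 17 * k ^ 2 + 6 * k + 1,
    16 * k ^ 5 + 36 * k ^ 4 + 33 * k ^ 3 + 14 * k ^ 2 + 2 * k,
    16 * k ^ 5 + 36 * k ^ 4 + 33 * k ^ 3 + 17 * k ^ 2 + 4 * k) := by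
  rw [combPow, combPow_4, combMul]
  ext <;> ring

theorem combPow_6 (k : ℚ) : combPow k 6 = (32 * k ^ 6 + 88 * k ^ 5 + 102 * k ^ 4 + 67 * k ^ 3 + 25 * k ^ 2 + 4 * k,
    32 * k ^ 6 + 88 * k ^ 5 + 102 * k ^ 4 + 63 * k ^ 3 + 23 * k ^ 2 + 6 * k + 1,
    32 * k ^ 6 + 88 * k ^ 5 + 102 * k ^ 4 + 64 * k ^ 3 + 20 * k ^ 2 + 2 * k) := by
  rw [combPow, combPow_5, combMul]
  ext <;> ring

theorem combPow_7 (k : ℚ) : combPow k 7 = (64 * k ^ 7 + 208 * k ^ 6 + 292 * k ^ 5 + 230 * k ^ 4 + 104 * k ^ 3 + 24 * k ^ 2 + 2 * k,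
    64 * k ^ 7 + 208 * k ^ 6 + 292 * k ^ 5 + 229 * k ^ 4 + 110 * k ^ 3 + 33 * k ^ 2 + 5 * k,
    64 * k ^ 7 + 208 * k ^ 6 + 292 * k ^ 5 + 229 * k ^ 4 + 106 * k ^ 3 + 31 * k ^ 2 + 7 * k + 1) := by
  rw [combPow, combPow_6, combMul]
  ext <;> ring

theorem IsDoublyRegularMatrix.sum_walkWeight_coincidenceTerm {V : Type*} [Fintype V]
    [DecidableEq V] {A : V → V → ℚ} {k : ℚ} (h : IsDoublyRegularMatrix A k) :
    ∑ x, walkWeight A x + 8 * ∑ x, walkWeight A x * coincidenceTerm x =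
      2 * ((k + 1) * (4 * k + 3) * (2 * k + 1) * k ^ 2 * (k - 1) * (16 * k ^ 2 - 4 * k - 11)) := by
  have e : ∀ x : Fin 8 → V, walkWeight A x * coincidenceTerm x =
      walkWeight A x * (coincidence x 0 4 * coincidence x 1 5)  / 2
      - walkWeight A x * (coincidence x 0 4) / 2
      + walkWeight A x * (coincidence x 0 4 * coincidence x 2 6) / 4
      - walkWeight A x * (coincidence x 0 4 * coincidence x 1 5 * coincidence x 2 6) / 2
      + walkWeight A x * (coincidence x 0 4 * coincidence x 1 5 * coincidence x 2 6 *
          coincidence x 3 7) / 8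
      - walkWeight A x * (coincidence x 0 3)
      + walkWeight A x * (coincidence x 0 3 * coincidence x 1 5)
      + walkWeight A x * (coincidence x 0 3 * coincidence x 2 6)
      - walkWeight A x * (coincidence x 0 3 * coincidence x 1 5 * coincidence x 2 6)
      + walkWeight A x * (coincidence x 0 3 * coincidence x 1 4)
      - walkWeight A x * (coincidence x 0 3 * coincidence x 1 4 * coincidence x 2 6)
      + walkWeight A x * (coincidence x 0 3 * coincidence x 2 5)
      - walkWeight A x * (coincidence x 0 3 * coincidence x 1 4 * coincidence x 2 5) := by
    intro x
    simp only [coincidenceTerm, Fin.isValue, Fin.reduceAdd]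
    ring
  simp only [e, sum_add_distrib, sum_sub_distrib, ← sum_div, h.sum_walkWeight,
    h.sum_walkWeight_04, h.sum_walkWeight_04_15, h.sum_walkWeight_04_26,
    h.sum_walkWeight_04_15_26, h.sum_walkWeight_04_15_26_37, h.sum_walkWeight_03,
    h.sum_walkWeight_03_15, h.sum_walkWeight_03_26, h.sum_walkWeight_03_15_26,
    h.sum_walkWeight_03_14, h.sum_walkWeight_03_14_26, h.sum_walkWeight_03_25,
    h.sum_walkWeight_03_14_25]
  have p0 : combPow k 0 = (0, 1, 0) := rfl
  simp only [p0, combPow_1, combPow_2, combPow_3, combPow_4, combPow_7, combSum, combSwap, combMul,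
    Prod.fst_mul, Prod.snd_mul]
  ring

theorem corollary1 {V : Type*} [Finite V] (T : Digraph V) (hT : IsDoublyRegularTournament T)
    (n : ℕ) (hn : Nat.card V = n) :
    (numCycles T 8 : ℚ) =
      ((n : ℚ) + 1) * n * (n - 1) * (n - 3) ^ 2 * (n - 7) * (n ^ 2 - 7 * n + 1) / (256 * 8) := by
  classical
  have := Fintype.ofFinite V
  have h := hT.isDoublyRegularMatrix
  rw [← Nat.card_eq_fintype_card, hn] at h
  have h1 := eight_mul_numCycles_eq h
  rw [h.sum_walkWeight_coincidenceTerm] at h1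
  -- With k = (n − 3)/4 one has n + 1 = 4(k + 1), n − 1 = 2(2k + 1), n − 7 = 4(k − 1) and n² − 7n +
  -- 1 = 16k² − 4k − 11.
  linear_combination h1 / 8
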